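/- **Setting.** Let $\mathcal X$ be a finite data universe, $D\in\mathcal X^n$ a database ($n\ge 1$), and let a linear query be a function $q:\mathcal X\to[0,1]$, with $q(D)=\frac1n\sum_{i} q(x^{(i)})$ and $\neg q=1-q$. Each of $m$ analysts submits a finite set $\overline{\mathcal Q}_{\mathrm{id}}$ of linear queries; put $\mathcal Q_{\mathrm{id}}=\overline{\mathcal Q}_{\mathrm{id}}\cup\neg\overline{\mathcal Q}_{\mathrm{id}}$ and $$\ell_{\mathrm{id}}(x)=\max_{q\in\mathcal Q_{\mathrm{id}}}\frac{1+q(D)-q(x)}{2}$$ (with $\ell_{\mathrm{id}}=\tfrac12$ if $\mathcal Q_{\mathrm{id}}=\emptyset$). Let $0<\varepsilon\le 1$, $0<\delta<1$, let $T\ge1$ be an integer number of rounds, and $$\eta=\frac{\varepsilon}{2\sqrt{T\log(1/\delta)}},\qquad s=12T\le m .$$ (The choice $T=\lceil n^{2/3}\max\{\log|\mathcal X|,\log m\}\rceil$ is a special case.) For a positive measure $A$ on $[m]$ with $|A|=\sum_a A(a)\le s$, let $\Gamma_sA(a)=\min\{1,cA(a)\}$, where $c\ge1$ is such that $\sum_a\min\{1,cA(a)\}=s$;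 a tilde denotes normalization to a probability distribution. **Algorithm (offline mechanism for linear queries).** Start with $D_0(x)=1/|\mathcal X|$ and $I_1(\mathrm{id})=1/m$. For $t=1,\dots,T$: * the analyst player samples $\hat{\mathrm{id}}_t$ from $\widetilde{\Gamma_s I_t}$; * the data player sets $D_t(x)=D_{t-1}(x)\,e^{-\eta\,\ell_{\hat{\mathrm{id}}_t}(x)}$ for all $x$ and samples $\hat x_t$ from $\widetilde D_t$; * the analyst player sets $I_{t+1}(\mathrm{id})=I_t(\mathrm{id})\,e^{-\eta\,\ell_{\mathrm{id}}(\hat x_t)}$ for all $\mathrm{id}\in[m]$. Let $\widehat D=(\hat x_1,\dots,\hat x_T)$ and $f_{\mathrm{id}}=\max_{q\in\mathcal Q_{\mathrm{id}}}|q(D)-q(\widehat D)|$ (and $0$ if $\mathcal Q_{\mathrm{id}}=\emptyset$). Sparse vector, with threshold $\alpha\in\mathbb R$, draws a noisy threshold $\theta$ and independent, identically distributed noise $\nu_1,\dots,\nu_m$, independent of $\theta$, and reports $I_f=\{\mathrm{id}: f_{\mathrm{id}}\ge\alpha,\ f_{\mathrm{id}}+\nu_{\mathrm{id}}\ge\theta\}$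 (so at most $s$ analysts are reported if at most $s$ of them have $f_{\mathrm{id}}\ge\alpha$); the laws of $\theta$ and of the noise are arbitrary fixed probability laws, e.g. Laplace laws. For each $\mathrm{id}\in I_f$ independently, a single-analyst mechanism $\mathcal A_{\mathrm{MW}}(D,\mathcal Q_{\mathrm{id}})$, which may be any randomized mechanism with any output space, is run with parameters $\varepsilon'=\frac{\varepsilon}{10\sqrt{s\log(3s/\delta)}}$ and $\delta'=\frac{\delta}{3s}$, giving $\vec a_{\mathrm{id}}$. The output $Z_{\mathrm{id}}$ to analyst $\mathrm{id}$ is $(\widehat D,\vec a_{\mathrm{id}})$ if $\mathrm{id}\in I_f$ and $(\widehat D,\bot)$ otherwise. **Theorem.** This algorithm $\mathcal A$ satisfies $(\varepsilon,\delta)$-one-analyst-to-many-analyst privacy: for every $D\in\mathcal X^n$, every $\mathrm{id}^*\in[m]$, all families $\mathcal Q=(\overline{\mathcal Q}_1,\dots,\overline{\mathcal Q}_m)$ and $\mathcal Q'=(\overline{\mathcal Q}'_1,\dots,\overline{\mathcal Q}'_m)$ with $\overline{\mathcal Q}_{\mathrm{id}}=\overline{\mathcal Q}'_{\mathrm{id}}$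 for all $\mathrm{id}\ne\mathrm{id}^*$, and every measurable set $S$ of joint outputs to the analysts other than $\mathrm{id}^*$, $$\Pr[\mathcal A(D,\mathcal Q)_{-\mathrm{id}^*}\in S]\le e^{\varepsilon}\,\Pr[\mathcal A(D,\mathcal Q')_{-\mathrm{id}^*}\in S]+\delta ,$$ where $\mathcal A(D,\mathcal Q)_{-\mathrm{id}^*}=(Z_{\mathrm{id}})_{\mathrm{id}\ne\mathrm{id}^*}$. -/

import Mathlib

open MeasureTheory

/-- A linear query on the data universe `X`: a function `q : X → [0,1]`. -/
abbrev LinearQuery (X : Type*) := X → unitInterval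

/-- The negated query `¬q = 1 - q`. -/
def LinearQuery.neg {X : Type*} (q : LinearQuery X) : LinearQuery X :=
  fun x => unitInterval.symm (q x)

/-- The value `q(D) = (1/n) ∑ᵢ q(xᵢ)` of a linear query on a database `D = (x₁, …, xₙ)`. -/
noncomputable def LinearQuery.eval {X : Type*} {n : ℕ} (q : LinearQuery X) (D : Fin n → X) : ℝ :=
  (1 / (n : ℝ)) * ∑ i, (q (D i) : ℝ)

/-- `(ε, δ)`-one-analyst-to-many-analyst privacy of a many-analyst mechanism `M`, which maps a
database and the query sets of the `m` analysts to the joint law of the `m` outputs: if two query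
profiles differ at most in the queries of analyst `a`, then the joint laws of the outputs to
all analysts other than `a` are `(ε, δ)`-indistinguishable. -/
def OneAnalystToManyAnalystPrivate {X O : Type*} [MeasurableSpace O] {n m : ℕ}
    (M : (Fin n → X) → (Fin m → Finset (LinearQuery X)) → Measure (Fin m → O))
    (ε δ : ℝ) : Prop :=
  ∀ (D : Fin n → X) (Q Q' : Fin m → Finset (LinearQuery X)) (a : Fin m),
    (∀ j, j ≠ a → Q j = Q' j) →
    ∀ S : Set ({j : Fin m // j ≠ a} → O), MeasurableSet S →
      ((M D Q).map fun z j => z j.1) S ≤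
        ENNReal.ofReal (Real.exp ε) * ((M D Q').map fun z j => z j.1) S + ENNReal.ofReal δ

namespace OfflineAnalyst

/-! ### Measures over a finite set of actions -/

/-- The probability vector `A / |A|` of a measure `A`, where `|A| = ∑ A(a)`. -/
noncomputable def normalize {A : Type*} [Fintype A] (w : A → ℝ) (a : A) : ℝ :=
  w a / ∑ b, w b

open Classical in
/-- The Bregman projection of `w` into the set of measures of density `s`:
`a ↦ min {1, c · w a}`, where `c ≥ 1` satisfies `∑ min {1, c · w a} = s`. Such a `c` exists whenever
`w` is positive and `|w| ≤ s ≤ |A|`, and the projection does not depend on which one is taken. -/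
noncomputable def proj {A : Type*} [Fintype A] (s : ℝ) (w : A → ℝ) : A → ℝ :=
  if h : ∃ c : ℝ, 1 ≤ c ∧ ∑ a, min 1 (c * w a) = s then fun a => min 1 (h.choose * w a) else w

/-! ### Losses and errors of an analyst -/

open Classical in
/-- The set `Q ∪ ¬Q`. -/
noncomputable def closeNeg {X : Type*} (Q : Finset (LinearQuery X)) : Finset (LinearQuery X) :=
  Q ∪ Q.image LinearQuery.neg

/-- `max_{q ∈ Q} (1 + q(D) - q(x)) / 2`; an analyst without queries has error `0`, hence
loss `1/2`. -/
noncomputable def loss {X : Type*} {n : ℕ} (D : Fin n → X) (Q : Finset (LinearQuery X)) (x : X) :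
    ℝ :=
  if h : Q.Nonempty then Q.sup' h fun q => (1 + q.eval D - (q x : ℝ)) / 2 else 1 / 2

/-- `max_{q ∈ Q} |q(D) - q(D̂)|`, and `0` for an analyst without queries. -/
noncomputable def maxError {X : Type*} {n T : ℕ} (D : Fin n → X) (Dhat : Fin T → X)
    (Q : Finset (LinearQuery X)) : ℝ :=
  if h : Q.Nonempty then Q.sup' h fun q => |q.eval D - q.eval Dhat| else 0

/-! ### The game between the data player and the analyst player

In round `t` the analyst player samples `ids t` and then the data player samples `xs t`. -/

section Game

variable {X : Type*} {n m T : ℕ}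

/-- The data player's measure in round `t`: starting from `1/|X|`, it has been multiplied by
`exp (-η · loss)` for each of the analysts received in the rounds up to and including `t`. -/
noncomputable def dataMeasure [Fintype X] (η : ℝ) (D : Fin n → X)
    (Q : Fin m → Finset (LinearQuery X)) (ids : Fin T → Fin m) (t : Fin T) (x : X) : ℝ :=
  (1 / (Fintype.card X : ℝ)) * ∏ j ∈ Finset.Iic t, Real.exp (-η * loss D (Q (ids j)) x)

/-- The analyst player's unprojected measure in round `t`: starting from `1/m`, it has been
multiplied by `exp (-η · loss)` for each of the data elements received in the rounds before `t`. -/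
noncomputable def analystMeasure (η : ℝ) (D : Fin n → X)
    (Q : Fin m → Finset (LinearQuery X)) (xs : Fin T → X) (t : Fin T) (i : Fin m) : ℝ :=
  (1 / (m : ℝ)) * ∏ j ∈ Finset.Iio t, Real.exp (-η * loss D (Q i) (xs j))

/-- The probability that the synthetic database `D̂ = (x̂₁, …, x̂_T)` played by the data player
equals `xs`: the sum, over all sequences of sampled analysts, of the product of the conditional
probabilities of all samples. -/
noncomputable def transcriptProb [Fintype X] (η s : ℝ) (D : Fin n → X)
    (Q : Fin m → Finset (LinearQuery X)) (xs : Fin T → X) : ℝ :=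
  ∑ ids : Fin T → Fin m, ∏ t,
    normalize (proj s (analystMeasure η D Q xs t)) (ids t) *
      normalize (dataMeasure η D Q ids t) (xs t)

end Game

/-! ### Sparse vector -/

open Classical in
/-- The indices that sparse vector reports for the values `f`: those with `f i ≥ α` whose noisy
value `f i + ν i` reaches the noisy threshold `θ`. In particular, at most `k` indices are reported
if at most `k` of the values are `≥ α`. -/
noncomputable def sparseVectorSelect {m : ℕ} (α : ℝ) (f : Fin m → ℝ) (θ : ℝ) (ν : Fin m → ℝ) :
    Finset (Fin m) :=
  {i | α ≤ f i ∧ θ ≤ f i + ν i}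

/-- The probability that sparse vector reports exactly the set `I`, when the noisy threshold has
law `thr` and each value receives independent noise of law `noise`. -/
noncomputable def sparseVectorProb {m : ℕ} (α : ℝ) (thr noise : ProbabilityMeasure ℝ)
    (f : Fin m → ℝ) (I : Finset (Fin m)) : ENNReal :=
  ((thr : Measure ℝ).prod (Measure.pi fun _ : Fin m => (noise : Measure ℝ)))
    {p | sparseVectorSelect α f p.1 p.2 = I}

/-! ### The mechanism -/

/-- What one analyst receives: the synthetic database `D̂`, and either an answer of the private
mechanism that handles single analysts (`Sum.inl`) or nothing else (`Sum.inr`). -/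
abbrev Output (X R : Type*) (T : ℕ) := (Fin T → X) × (R ⊕ Unit)

/-- The offline mechanism for linear queries with `T` rounds. `MW ε' δ' D Q` is the output law of
the mechanism, run with parameters `ε'` and `δ'`, that answers the queries `Q` of each analyst
reported by sparse vector. The law of the outputs to the `m` analysts is written as the mixture,
over the synthetic database `xs` and the reported set `I`, of the conditional laws, which are
products because the runs of `MW` are independent. -/
noncomputable def mechanism {X R : Type*} [Fintype X] [MeasurableSpace X] [MeasurableSpace R]
    {n m : ℕ} (T : ℕ) (ε δ α : ℝ) (thr noise : ProbabilityMeasure ℝ)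
    (MW : ℝ → ℝ → (Fin n → X) → Finset (LinearQuery X) → ProbabilityMeasure R)
    (D : Fin n → X) (Qbar : Fin m → Finset (LinearQuery X)) : Measure (Fin m → Output X R T) :=
  let Q : Fin m → Finset (LinearQuery X) := fun i => closeNeg (Qbar i)
  let η : ℝ := ε / (2 * √(T * Real.log (1 / δ)))
  let s : ℝ := 12 * T
  let ε' : ℝ := ε / (10 * √(s * Real.log (3 * s / δ)))
  let δ' : ℝ := δ / (3 * s)
  ∑ xs : Fin T → X, ∑ I : Finset (Fin m),
    (ENNReal.ofReal (transcriptProb η s D Q xs) *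
        sparseVectorProb α thr noise (fun i => maxError D xs (Q i)) I) •
      Measure.pi fun i =>
        if i ∈ I then (MW ε' δ' D (Q i) : Measure R).map fun r => (xs, Sum.inl r)
        else Measure.dirac (xs, Sum.inr ())

end OfflineAnalyst

namespace OfflineAnalyst

/-! ### Sums over histories -/

/-! Given `D̂`, the outputs to the analysts other than `a` have the same law under both profiles:
sparse vector compares each value with its own noise and a shared threshold. The event thus becomes
a `[0,1]`-valued test function `φ` of `D̂`, and it remains to prove privacy of `D̂`
(`sum_mul_transcriptProb_le`).

Given the data elements already played, the sampling law of the analyst player is known, so the law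
of `D̂` is a `mixture` over hidden sequences of sampled analysts ("tokens"). The queries of `a`
enter through these sampling laws and through the loss used when `a` is sampled. Rounds are switched
from one profile to the other one at a time (`sum_mul_mixture_le_pow`).

Two facts control the switch of one round. Projection caps the probability of every analyst at
`1/s`, so the two sampling laws share mass at least `1 - 1/s` on analysts other than `a`, whose
losses are unchanged. On the remaining mass, one token is replaced by another; losses lie in `[1/2,
1]`, so every log weight moves by at most `η/2`. A Rényi bound for Gibbs distributions, multiplied
over the rounds and turned into a tail bound, shows that such a replacement costs a factor `exp u`
and a small additive error. Subsampling amplification (`sum_mul_mixture_exchange_le`) reduces the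
factor to `1 + (exp u - 1)/s`. Over `T = s/12` rounds, with `u = ε`, this stays below `exp ε`. -/

/-- A sum over histories of a product of adapted nonnegative factors is at most the product of
uniform bounds on the one-round sums. -/
theorem sum_prod_adapted_le {Z : Type*} [Fintype Z] [Nonempty Z] {T : ℕ}
    (f : Fin T → (Fin T → Z) → ℝ) (K : Fin T → ℝ) (hf : ∀ t z, 0 ≤ f t z)
    (hdep : ∀ t z z', (∀ j ≤ t, z j = z' j) → f t z = f t z')
    (hsum : ∀ t z, ∑ y, f t (Function.update z t y) ≤ K t) :
    ∑ z, ∏ t, f t z ≤ ∏ t, K t := by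
  induction T with
  | zero => simp
  | succ T ih =>
    obtain ⟨y₀⟩ := ‹Nonempty Z›
    have hK : ∀ t, 0 ≤ K t := fun t =>
      (Finset.sum_nonneg fun y _ => hf t _).trans (hsum t fun _ => y₀)
    -- Factors of earlier rounds do not see the last entry, so the arbitrary `y₀` can stand for it
    -- when the last round is summed out.
    have hdep' : ∀ (t : Fin T) (z : Fin T → Z) (y y' : Z),
        f t.castSucc (Fin.snoc z y : Fin (T + 1) → Z) = f t.castSucc (Fin.snoc z y') := by
      intro t z y y'
      refine hdep _ _ _ fun j hj => ?_
      obtain ⟨i, rfl⟩ : ∃ i : Fin T, i.castSucc = j :=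
        Fin.exists_castSucc_eq.2 (ne_of_lt (lt_of_le_of_lt hj (Fin.castSucc_lt_last t)))
      simp
    rw [← (Fin.snocEquiv fun _ : Fin (T + 1) => Z).sum_comp, Fintype.sum_prod_type,
      Finset.sum_comm, Fin.prod_univ_castSucc]
    have h1 : ∀ z : Fin T → Z,
        ∑ y, ∏ t, f t (Fin.snocEquiv (fun _ : Fin (T + 1) => Z) (y, z)) ≤
          (∏ t : Fin T, f t.castSucc (Fin.snoc z y₀ : Fin (T + 1) → Z)) * K (Fin.last T) := by
      intro z
      have h2 : ∀ y, ∏ t, f t (Fin.snocEquiv (fun _ : Fin (T + 1) => Z) (y, z)) =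
          (∏ t : Fin T, f t.castSucc (Fin.snoc z y₀ : Fin (T + 1) → Z)) *
            f (Fin.last T) (Function.update (Fin.snoc z y₀ : Fin (T + 1) → Z) (Fin.last T) y) := by
        intro y
        rw [Fin.prod_univ_castSucc, Fin.update_snoc_last]
        congr 1
        exact Finset.prod_congr rfl fun t _ => hdep' t z _ _
      simp_rw [h2, ← Finset.mul_sum]
      exact mul_le_mul_of_nonneg_left (hsum _ _) (Finset.prod_nonneg fun t _ => hf _ _)
    refine (Finset.sum_le_sum fun z _ => h1 z).trans ?_
    rw [← Finset.sum_mul]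
    refine mul_le_mul_of_nonneg_right ?_ (hK _)
    refine ih (fun t z => f t.castSucc (Fin.snoc z y₀ : Fin (T + 1) → Z)) _ (fun _ _ => hf _ _)
      (fun t z z' h => hdep _ _ _ fun j hj => ?_) (fun t z => ?_)
    · obtain ⟨i, rfl⟩ : ∃ i : Fin T, i.castSucc = j :=
        Fin.exists_castSucc_eq.2 (ne_of_lt (lt_of_le_of_lt hj (Fin.castSucc_lt_last t)))
      simpa using h i (by simpa using hj)
    · refine le_trans (le_of_eq ?_) (hsum t.castSucc (Fin.snoc z y₀ : Fin (T + 1) → Z))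
      exact Finset.sum_congr rfl fun y _ => by rw [Fin.snoc_update]

/-! ### Gibbs distributions -/

/-- The probability vector proportional to `exp (W x)`. -/
noncomputable def gibbs {X : Type*} [Fintype X] (W : X → ℝ) (x : X) : ℝ :=
  Real.exp (W x) / ∑ y, Real.exp (W y)

section Gibbs

variable {X : Type*} [Fintype X]

theorem sum_exp_pos [Nonempty X] (W : X → ℝ) : 0 < ∑ y, Real.exp (W y) :=
  Finset.sum_pos (fun _ _ => Real.exp_pos _) Finset.univ_nonempty

theorem gibbs_pos [Nonempty X] (W : X → ℝ) (x : X) : 0 < gibbs W x :=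
  div_pos (Real.exp_pos _) (sum_exp_pos W)

theorem sum_gibbs [Nonempty X] (W : X → ℝ) : ∑ x, gibbs W x = 1 := by
  simp_rw [gibbs, ← Finset.sum_div]
  exact div_self (sum_exp_pos W).ne'

/-- Hoeffding's lemma for a probability vector. -/
theorem sum_mul_exp_le (q d : X → ℝ) (hq : ∀ x, 0 ≤ q x) (hq1 : ∑ x, q x = 1) (c : ℝ)
    (hd : ∀ x, |d x| ≤ c) (l : ℝ) :
    ∑ x, q x * Real.exp (l * d x) ≤ Real.exp (l * ∑ x, q x * d x + l ^ 2 * c ^ 2 / 2) := by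
  classical
  let _ : MeasurableSpace X := ⊤
  have hsum : ∑ x, ENNReal.ofReal (q x) = 1 := by
    rw [← ENNReal.ofReal_sum_of_nonneg fun x _ => hq x, hq1, ENNReal.ofReal_one]
  set P : PMF X := PMF.ofFintype (fun x => ENNReal.ofReal (q x)) hsum with hP
  have hint : ∀ f : X → ℝ, ∫ x, f x ∂P.toMeasure = ∑ x, q x * f x := by
    intro f
    rw [PMF.integral_eq_sum]
    refine Finset.sum_congr rfl fun x _ => ?_
    rw [hP, PMF.ofFintype_apply, ENNReal.toReal_ofReal (hq x), smul_eq_mul]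
  have hmean : |∑ x, q x * d x| ≤ c := by
    refine (Finset.abs_sum_le_sum_abs _ _).trans ?_
    calc ∑ x, |q x * d x| ≤ ∑ x, q x * c := Finset.sum_le_sum fun x _ => by
          rw [abs_mul, abs_of_nonneg (hq x)]
          exact mul_le_mul_of_nonneg_left (hd x) (hq x)
      _ = c := by rw [← Finset.sum_mul, hq1, one_mul]
  have hc : 0 ≤ c := (abs_nonneg _).trans hmean
  have h := (ProbabilityTheory.hasSubgaussianMGF_of_mem_Icc (μ := P.toMeasure) (X := d)
    (a := -c) (b := c) (measurable_from_top).aemeasurable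
    (Filter.Eventually.of_forall fun x => abs_le.1 (hd x))).mgf_le l
  rw [ProbabilityTheory.mgf, hint, hint] at h
  -- Hoeffding's variance proxy is the squared half-length of `[-c, c]`.
  have hc2 : (((‖c - -c‖₊ / 2) ^ 2 : NNReal) : ℝ) = c ^ 2 := by
    push_cast
    rw [Real.norm_eq_abs, show c - -c = 2 * c by ring, abs_of_nonneg (by positivity)]
    ring
  rw [hc2] at h
  calc ∑ x, q x * Real.exp (l * d x)
      = Real.exp (l * ∑ x, q x * d x) *
          ∑ x, q x * Real.exp (l * (d x - ∑ x, q x * d x)) := by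
        rw [Finset.mul_sum]
        refine Finset.sum_congr rfl fun x _ => ?_
        rw [mul_sub, sub_eq_add_neg, Real.exp_add, Real.exp_neg]
        field_simp
    _ ≤ Real.exp (l * ∑ x, q x * d x) * Real.exp (c ^ 2 * l ^ 2 / 2) :=
        mul_le_mul_of_nonneg_left h (Real.exp_pos _).le
    _ = _ := by rw [← Real.exp_add]; ring_nf

/-- A bound on the Rényi divergence between two Gibbs distributions with close exponents. -/
theorem sum_gibbs_mul_rpow_le [Nonempty X] (W W' : X → ℝ) (c : ℝ)
    (h : ∀ x, |W' x - W x| ≤ c) {l : ℝ} (hl : 0 ≤ l) :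
    ∑ x, gibbs W x * (gibbs W x / gibbs W' x) ^ l ≤ Real.exp (l * (l + 1) * c ^ 2 / 2) := by
  set d : X → ℝ := fun x => W' x - W x with hd
  set E : ℝ := ∑ x, gibbs W x * Real.exp (d x) with hE
  have hq := fun x => (gibbs_pos W x).le
  have hE0 : 0 < E := Finset.sum_pos (fun x _ => mul_pos (gibbs_pos W x) (Real.exp_pos _))
    Finset.univ_nonempty
  have hEZ : E = (∑ y, Real.exp (W' y)) / ∑ y, Real.exp (W y) := by
    rw [hE, Finset.sum_div]
    refine Finset.sum_congr rfl fun x _ => ?_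
    rw [gibbs, hd, div_mul_eq_mul_div, ← Real.exp_add]
    congr 2
    ring
  -- The ratio of the normalizing constants is the exponential moment `E`. Hoeffding at `1` bounds
  -- `E`, and at `-l` bounds the moment of `exp (-d)`; the terms linear in the mean `μ` then cancel.
  have hratio : ∀ x, gibbs W x / gibbs W' x = Real.exp (-d x) * E := by
    intro x
    have h1 := sum_exp_pos W
    have h2 := sum_exp_pos W'
    rw [hEZ, gibbs, gibbs, hd, neg_sub, Real.exp_sub]
    have := Real.exp_pos (W' x)
    field_simp
  have h1 := sum_mul_exp_le (gibbs W) d hq (sum_gibbs W) c h 1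
  have h2 := sum_mul_exp_le (gibbs W) d hq (sum_gibbs W) c h (-l)
  set μ := ∑ x, gibbs W x * d x
  simp only [one_mul] at h1
  calc ∑ x, gibbs W x * (gibbs W x / gibbs W' x) ^ l
      = (∑ x, gibbs W x * Real.exp (-l * d x)) * E ^ l := by
        rw [Finset.sum_mul]
        refine Finset.sum_congr rfl fun x _ => ?_
        rw [hratio, Real.mul_rpow (Real.exp_pos _).le hE0.le, ← Real.exp_mul, mul_assoc]
        congr 3
        ring
    _ ≤ Real.exp (-l * μ + (-l) ^ 2 * c ^ 2 / 2) * (Real.exp (μ + 1 ^ 2 * c ^ 2 / 2)) ^ l := by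
        gcongr
    _ = _ := by
        rw [← Real.exp_mul, ← Real.exp_add]
        ring_nf

end Gibbs

/-! ### Transcripts of a generalized game -/

section Mixture

variable {X Y J : Type*} {T : ℕ}

/-- The logarithm of the data player's weights after round `t`, when token `y` in round `j` stands
for the loss `g j y`. -/
noncomputable def logWeight (η : ℝ) (g : Fin T → Y → X → ℝ) (ys : Fin T → Y) (t : Fin T) (x : X) :
    ℝ :=
  -η * ∑ j ∈ Finset.Iic t, g j (ys j) x

/-- The total weight of the transcript `xs`, when the token of round `t` has weights `π t xs`. -/
noncomputable def mixture [Fintype X] [Fintype Y] (η : ℝ) (π : Fin T → (Fin T → X) → Y → ℝ)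
    (g : Fin T → Y → X → ℝ) (xs : Fin T → X) : ℝ :=
  ∑ ys : Fin T → Y, ∏ t, π t xs (ys t) * gibbs (logWeight η g ys t) (xs t)

/-- A function of the transcript that depends only on the rounds before `t`. -/
def DependsBefore {A : Type*} (t : Fin T) (F : (Fin T → X) → A) : Prop :=
  ∀ xs xs', (∀ j < t, xs j = xs' j) → F xs = F xs'

theorem logWeight_congr (η : ℝ) (g : Fin T → Y → X → ℝ) (ys ys' : Fin T → Y) (t : Fin T)
    (h : ∀ j ≤ t, ys j = ys' j) : logWeight η g ys t = logWeight η g ys' t := by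
  funext x
  unfold logWeight
  congr 1
  exact Finset.sum_congr rfl fun j hj => by rw [h j (Finset.mem_Iic.1 hj)]

variable [Fintype X] [Fintype Y] [Fintype J]

theorem mixture_nonneg [Nonempty X] (η : ℝ) (π : Fin T → (Fin T → X) → Y → ℝ)
    (g : Fin T → Y → X → ℝ) (xs : Fin T → X) (h : ∀ t y, 0 ≤ π t xs y) :
    0 ≤ mixture η π g xs :=
  Finset.sum_nonneg fun _ _ => Finset.prod_nonneg fun _ _ => mul_nonneg (h _ _) (gibbs_pos _ _).le

/-- A sequence containing a token of weight zero contributes nothing, so losses matter only on the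
support of the weights. -/
theorem mixture_congr (η : ℝ) {π π' : Fin T → (Fin T → X) → Y → ℝ} {g g' : Fin T → Y → X → ℝ}
    {xs : Fin T → X}
    (h : ∀ t y, π t xs y = π' t xs y ∧ (π t xs y ≠ 0 → g t y = g' t y)) :
    mixture η π g xs = mixture η π' g' xs := by
  refine Finset.sum_congr rfl fun ys _ => ?_
  by_cases h0 : ∃ t, π t xs (ys t) = 0
  · obtain ⟨t, ht⟩ := h0
    rw [Finset.prod_eq_zero (Finset.mem_univ t) (by rw [ht, zero_mul]),
      Finset.prod_eq_zero (Finset.mem_univ t) (by rw [← (h t _).1, ht, zero_mul])]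
  · push Not at h0
    refine Finset.prod_congr rfl fun t _ => ?_
    rw [(h t _).1]
    congr 2
    funext x
    unfold logWeight
    congr 1
    exact Finset.sum_congr rfl fun j _ => by rw [(h j _).2 (h0 j)]

/-- Tokens that stand for the same losses may be merged. -/
theorem mixture_comp [DecidableEq J] (η : ℝ) (π : Fin T → (Fin T → X) → Y → ℝ) (f : Y → J)
    (g : Fin T → J → X → ℝ) (xs : Fin T → X) :
    mixture η π (fun t y => g t (f y)) xs =
      mixture η (fun t xs j => ∑ y with f y = j, π t xs y) g xs := by
  classical
  unfold mixture
  rw [← Finset.sum_fiberwise (s := Finset.univ) (g := fun ys : Fin T → Y => fun t => f (ys t))]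
  refine Finset.sum_congr rfl fun ids _ => ?_
  simp_rw [Finset.prod_mul_distrib]
  rw [Finset.prod_univ_sum, Finset.sum_mul]
  refine Finset.sum_congr ?_ fun ys hys => ?_
  · ext ys
    simp [Fintype.mem_piFinset, funext_iff]
  · congr 1
    refine Finset.prod_congr rfl fun t _ => ?_
    congr 1
    funext x
    unfold logWeight
    have : ∀ t, f (ys t) = ids t := by simpa [Fintype.mem_piFinset] using hys
    simp_rw [this]

/-- Isolates the weight of round `r`, in which the mixture is linear for each fixed transcript;
scalars may therefore depend on the transcript. -/
theorem mixture_update_apply (η : ℝ) (p : Fin T → (Fin T → X) → J → ℝ) (r : Fin T)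
    (v : (Fin T → X) → J → ℝ) (g : Fin T → J → X → ℝ) (xs : Fin T → X) :
    mixture η (Function.update p r v) g xs =
      ∑ ys : Fin T → J, v xs (ys r) * (gibbs (logWeight η g ys r) (xs r) *
        ∏ t ∈ Finset.univ.erase r, p t xs (ys t) * gibbs (logWeight η g ys t) (xs t)) := by
  refine Finset.sum_congr rfl fun ys _ => ?_
  rw [← Finset.mul_prod_erase _ _ (Finset.mem_univ r), Function.update_self, mul_assoc]
  congr 2
  exact Finset.prod_congr rfl fun t ht => by
    rw [Function.update_of_ne (Finset.ne_of_mem_erase ht)]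

theorem mixture_update_add (η : ℝ) (p : Fin T → (Fin T → X) → J → ℝ) (r : Fin T)
    (v w : (Fin T → X) → J → ℝ) (g : Fin T → J → X → ℝ) (xs : Fin T → X) :
    mixture η (Function.update p r (v + w)) g xs =
      mixture η (Function.update p r v) g xs + mixture η (Function.update p r w) g xs := by
  simp_rw [mixture_update_apply, Pi.add_apply, add_mul, Finset.sum_add_distrib]

theorem mixture_update_mul (η : ℝ) (p : Fin T → (Fin T → X) → J → ℝ) (r : Fin T)
    (b : (Fin T → X) → ℝ) (v : (Fin T → X) → J → ℝ) (g : Fin T → J → X → ℝ) (xs : Fin T → X) :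
    mixture η (Function.update p r fun xs j => b xs * v xs j) g xs =
      b xs * mixture η (Function.update p r v) g xs := by
  simp_rw [mixture_update_apply, mul_assoc, Finset.mul_sum]

/-- Markov's inequality in pointwise form: where `a / b` exceeds `exp u`, its `l`-th power exceeds
`exp (l * u)`. Summed up, it turns a Rényi bound into an approximate-privacy bound. -/
theorem le_exp_mul_add_rpow {a b : ℝ} (ha : 0 < a) (hb : 0 < b) {l : ℝ} (hl : 0 ≤ l) (u : ℝ) :
    a ≤ Real.exp u * b + Real.exp (-(l * u)) * (a * (a / b) ^ l) := by
  have h0 : 0 ≤ Real.exp (-(l * u)) * (a * (a / b) ^ l) := by positivity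
  have h0' : 0 ≤ Real.exp u * b := by positivity
  rcases le_total a (Real.exp u * b) with h | h
  · linarith
  · have h1 : Real.exp (l * u) ≤ (a / b) ^ l := by
      rw [mul_comm, Real.exp_mul]
      exact Real.rpow_le_rpow (Real.exp_pos _).le ((le_div_iff₀ hb).2 h) hl
    have h2 : a ≤ Real.exp (-(l * u)) * (a * (a / b) ^ l) := by
      calc a = Real.exp (-(l * u)) * (a * Real.exp (l * u)) := by
            rw [Real.exp_neg]; field_simp
        _ ≤ _ := by gcongr
    linarith

/-- Two games with the same tokens whose log weights are always `c`-close have close transcripts. -/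
theorem sum_mul_mixture_le [Nonempty X] [Nonempty Y] (η : ℝ) (π : Fin T → (Fin T → X) → Y → ℝ)
    (B : Fin T → ℝ) (hπ : ∀ t xs y, 0 ≤ π t xs y) (hdep : ∀ t, DependsBefore t (π t))
    (hB : ∀ t xs, ∑ y, π t xs y ≤ B t) (g g' : Fin T → Y → X → ℝ) (c : ℝ)
    (hg : ∀ t ys x, |logWeight η g' ys t x - logWeight η g ys t x| ≤ c)
    (φ : (Fin T → X) → ℝ) (hφ : ∀ xs, 0 ≤ φ xs) (hφ1 : ∀ xs, φ xs ≤ 1) {l : ℝ} (hl : 0 ≤ l)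
    (u : ℝ) :
    ∑ xs, φ xs * mixture η π g xs ≤ Real.exp u * ∑ xs, φ xs * mixture η π g' xs +
      Real.exp (-(l * u)) * ∏ t, (B t * Real.exp (l * (l + 1) * c ^ 2 / 2)) := by
  set q : (Fin T → X) → (Fin T → Y) → Fin T → ℝ := fun xs ys t =>
    gibbs (logWeight η g ys t) (xs t) with hq
  set q' : (Fin T → X) → (Fin T → Y) → Fin T → ℝ := fun xs ys t =>
    gibbs (logWeight η g' ys t) (xs t) with hq'
  have hq0 : ∀ xs ys t, 0 < q xs ys t := fun _ _ _ => gibbs_pos _ _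
  have hq0' : ∀ xs ys t, 0 < q' xs ys t := fun _ _ _ => gibbs_pos _ _
  set f : (Fin T → X) → (Fin T → Y) → Fin T → ℝ := fun xs ys t =>
    π t xs (ys t) * (q xs ys t * (q xs ys t / q' xs ys t) ^ l) with hf
  have hf0 : ∀ xs ys t, 0 ≤ f xs ys t := fun xs ys t => mul_nonneg (hπ _ _ _)
    (mul_nonneg (hq0 _ _ _).le (Real.rpow_nonneg (div_pos (hq0 _ _ _) (hq0' _ _ _)).le _))
  have hpt : ∀ xs ys, φ xs * ∏ t, π t xs (ys t) * q xs ys t ≤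
      Real.exp u * (φ xs * ∏ t, π t xs (ys t) * q' xs ys t) +
        Real.exp (-(l * u)) * ∏ t, f xs ys t := by
    intro xs ys
    have h1 := le_exp_mul_add_rpow (Finset.prod_pos fun t (_ : t ∈ Finset.univ) => hq0 xs ys t)
      (Finset.prod_pos fun t (_ : t ∈ Finset.univ) => hq0' xs ys t) hl u
    rw [← Finset.prod_div_distrib, ← Real.finsetProd_rpow _ _
      (fun t _ => (div_pos (hq0 xs ys t) (hq0' xs ys t)).le), ← Finset.prod_mul_distrib] at h1
    have hA : 0 ≤ ∏ t, π t xs (ys t) := Finset.prod_nonneg fun t _ => hπ _ _ _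
    have hF : 0 ≤ ∏ t, f xs ys t := Finset.prod_nonneg fun t _ => hf0 _ _ _
    have h2 := mul_le_mul_of_nonneg_left h1 (mul_nonneg (hφ xs) hA)
    have h3 : φ xs * (Real.exp (-(l * u)) * ∏ t, f xs ys t) ≤
        Real.exp (-(l * u)) * ∏ t, f xs ys t :=
      mul_le_of_le_one_left (mul_nonneg (Real.exp_pos _).le hF) (hφ1 xs)
    simp only [hf, Finset.prod_mul_distrib] at h2 h3 ⊢
    linarith
  have hchain : ∑ xs, ∑ ys, ∏ t, f xs ys t ≤
      ∏ t, (B t * Real.exp (l * (l + 1) * c ^ 2 / 2)) := by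
    -- Chain rule for the Rényi moment, with the pair (data element, token) as the history of a
    -- round.
    have key := sum_prod_adapted_le (Z := X × Y)
      (fun t z => f (fun j => (z j).1) (fun j => (z j).2) t)
      (fun t => B t * Real.exp (l * (l + 1) * c ^ 2 / 2))
      (fun t z => hf0 (fun j => (z j).1) (fun j => (z j).2) t) ?_ ?_
    · refine le_trans (le_of_eq ?_) key
      rw [← Fintype.sum_prod_type',
        ← (Equiv.arrowProdEquivProdArrow (Fin T) (fun _ => X) (fun _ => Y)).sum_comp]
      rfl
    · intro t z z' h
      simp only [hf, hq, hq']
      rw [hdep t (fun j => (z j).1) (fun j => (z' j).1) fun j hj => by rw [h j hj.le],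
        logWeight_congr η g (fun j => (z j).2) (fun j => (z' j).2) t fun j hj => by rw [h j hj],
        logWeight_congr η g' (fun j => (z j).2) (fun j => (z' j).2) t fun j hj => by rw [h j hj],
        h t le_rfl]
    · intro t z
      set xs : Fin T → X := fun j => (z j).1
      have hx : ∀ x y, f (fun j => (Function.update z t (x, y) j).1)
          (fun j => (Function.update z t (x, y) j).2) t = π t xs y *
            (gibbs (logWeight η g (Function.update (fun j => (z j).2) t y) t) x *
            (gibbs (logWeight η g (Function.update (fun j => (z j).2) t y) t) x /
            gibbs (logWeight η g' (Function.update (fun j => (z j).2) t y) t) x) ^ l) := by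
        intro x y
        have h2 : (fun j => (Function.update z t (x, y) j).2) =
            Function.update (fun j => (z j).2) t y := by
          funext j
          rcases eq_or_ne j t with rfl | hj <;> simp [*]
        simp only [hf, hq, hq', h2, Function.update_self]
        rw [hdep t (fun j => (Function.update z t (x, y) j).1) xs fun j hj => by
          simp [Function.update_of_ne hj.ne, xs]]
      -- The data element is summed first, for a fixed token, because its law already uses the loss
      -- of the current token.
      rw [Fintype.sum_prod_type, Finset.sum_comm]
      simp_rw [hx, ← Finset.mul_sum]
      calc _ ≤ ∑ y, π t xs y * Real.exp (l * (l + 1) * c ^ 2 / 2) :=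
            Finset.sum_le_sum fun y _ => mul_le_mul_of_nonneg_left
              (sum_gibbs_mul_rpow_le _ _ c (hg t _) hl) (hπ _ _ _)
        _ ≤ _ := by
            rw [← Finset.sum_mul]
            exact mul_le_mul_of_nonneg_right (hB t xs) (Real.exp_pos _).le
  calc ∑ xs, φ xs * mixture η π g xs
      = ∑ xs, ∑ ys, φ xs * ∏ t, π t xs (ys t) * q xs ys t := by
        simp_rw [mixture, Finset.mul_sum, hq]
    _ ≤ ∑ xs, ∑ ys, (Real.exp u * (φ xs * ∏ t, π t xs (ys t) * q' xs ys t) +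
        Real.exp (-(l * u)) * ∏ t, f xs ys t) :=
        Finset.sum_le_sum fun xs _ => Finset.sum_le_sum fun ys _ => hpt xs ys
    _ = Real.exp u * ∑ xs, φ xs * mixture η π g' xs +
        Real.exp (-(l * u)) * ∑ xs, ∑ ys, ∏ t, f xs ys t := by
        simp_rw [mixture, Finset.mul_sum, Finset.sum_add_distrib, hq']
    _ ≤ _ := by gcongr

end Mixture

/-! ### Switching a single round: coupling and amplification -/

section Exchange

variable {X J : Type*} [Fintype X] [Fintype J] {T : ℕ}

/-- Changing the tokens of a single round, whose weight is at most `b`, according to a coupling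
`w`. -/
theorem sum_mul_mixture_update_le [Nonempty X] [Nonempty J] {η : ℝ} (hη : 0 ≤ η) (r : Fin T)
    (p : Fin T → (Fin T → X) → J → ℝ) (hp : ∀ t xs j, 0 ≤ p t xs j)
    (hdep : ∀ t, DependsBefore t (p t)) (hp1 : ∀ t xs, ∑ j, p t xs j = 1)
    (w : (Fin T → X) → J → J → ℝ) (hw : ∀ xs j i, 0 ≤ w xs j i) (hwdep : DependsBefore r w)
    (b : ℝ) (hw1 : ∀ xs, ∑ j, ∑ i, w xs j i ≤ b) (g g' : Fin T → J → X → ℝ)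
    (hg : ∀ t, t ≠ r → g t = g' t) (hgr : ∀ j i x, |g r j x - g' r i x| ≤ 1 / 2)
    (φ : (Fin T → X) → ℝ) (hφ : ∀ xs, 0 ≤ φ xs) (hφ1 : ∀ xs, φ xs ≤ 1) {l : ℝ} (hl : 0 ≤ l)
    (u : ℝ) :
    ∑ xs, φ xs * mixture η (Function.update p r fun xs j => ∑ i, w xs j i) g xs ≤
      Real.exp u * ∑ xs, φ xs * mixture η (Function.update p r fun xs i => ∑ j, w xs j i) g' xs +
      b * Real.exp (-(l * u) + T * (l * (l + 1) * η ^ 2 / 8)) := by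
  classical
  -- Tokens become pairs: coupled by `w` in round `r`, diagonal elsewhere. Merging pairs by either
  -- coordinate recovers the two games.
  set π : Fin T → (Fin T → X) → J × J → ℝ := fun t xs y =>
    if t = r then w xs y.1 y.2 else if y.1 = y.2 then p t xs y.1 else 0 with hπ
  -- Outside round `r` the first coordinate is used, so that the log weights are close for all
  -- pairs, even off-diagonal ones of weight zero.
  set G' : Fin T → J × J → X → ℝ := fun t y => if t = r then g' t y.2 else g t y.1 with hG'
  have hfst : ∀ xs, mixture η π (fun t y => g t y.1) xs =
      mixture η (Function.update p r fun xs j => ∑ i, w xs j i) g xs := by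
    intro xs
    rw [mixture_comp η π Prod.fst g xs]
    refine mixture_congr η fun t j => ⟨?_, fun _ => rfl⟩
    rw [Finset.sum_filter, Fintype.sum_prod_type]
    rcases eq_or_ne t r with rfl | ht
    · simp [hπ, Finset.sum_ite_irrel]
    · simp [hπ, ht, Finset.sum_ite_irrel]
  have hsnd : ∀ xs, mixture η π G' xs =
      mixture η (Function.update p r fun xs i => ∑ j, w xs j i) g' xs := by
    intro xs
    have h1 : mixture η π G' xs = mixture η π (fun t y => g' t y.2) xs := by
      refine mixture_congr η fun t y => ⟨rfl, fun h => ?_⟩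
      rcases eq_or_ne t r with rfl | ht
      · simp [hG']
      · have : y.1 = y.2 := by
          by_contra hne
          exact h (by simp [hπ, ht, hne])
        simp [hG', ht, this, hg t ht]
    rw [h1, mixture_comp η π Prod.snd g' xs]
    refine mixture_congr η fun t j => ⟨?_, fun _ => rfl⟩
    rw [Finset.sum_filter, Fintype.sum_prod_type]
    rcases eq_or_ne t r with rfl | ht
    · simp [hπ]
    · simp [hπ, ht]
  have key := sum_mul_mixture_le η π (fun t => if t = r then b else 1) ?_ ?_ ?_
    (fun t y => g t y.1) G' (η / 2) ?_ φ hφ hφ1 hl u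
  · simp_rw [hfst, hsnd] at key
    refine key.trans (le_of_eq ?_)
    rw [Finset.prod_mul_distrib, Finset.prod_ite_eq' Finset.univ r, Finset.prod_const,
      ← Real.exp_nat_mul, Real.exp_add]
    simp only [Finset.mem_univ, if_true, Finset.card_univ, Fintype.card_fin]
    rw [show l * (l + 1) * (η / 2) ^ 2 / 2 = l * (l + 1) * η ^ 2 / 8 by ring]
    ring
  · intro t xs y
    simp only [hπ]
    split_ifs
    exacts [hw _ _ _, hp _ _ _, le_rfl]
  · intro t xs xs' h
    funext y
    simp only [hπ]
    split_ifs with h1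
    · subst h1
      rw [hwdep xs xs' h]
    · rw [hdep t xs xs' h]
    · rfl
  · intro t xs
    rcases eq_or_ne t r with rfl | ht
    · simpa [hπ, Fintype.sum_prod_type] using hw1 xs
    · simpa [hπ, ht, Fintype.sum_prod_type] using (hp1 t xs).le
  · intro t ys x
    unfold logWeight
    rw [← mul_sub, ← Finset.sum_sub_distrib, abs_mul, abs_neg, abs_of_nonneg hη]
    have h2 : ∀ j ∈ Finset.Iic t, G' j (ys j) x - g j (ys j).1 x =
        if j = r then g' r (ys r).2 x - g r (ys r).1 x else 0 := by
      intro j _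
      rcases eq_or_ne j r with rfl | hj <;> simp [*]
    rw [Finset.sum_congr rfl h2, Finset.sum_ite_eq']
    rw [div_eq_mul_inv, ← one_div]
    refine mul_le_mul_of_nonneg_left ?_ hη
    split_ifs
    · rw [abs_sub_comm]
      exact hgr _ _ _
    · norm_num

/-- Privacy amplification: changing the token distribution and the losses in a single round, where
the distributions agree up to mass `β` on tokens with unchanged losses. -/
theorem sum_mul_mixture_exchange_le [Nonempty X] [DecidableEq J] {η : ℝ} (hη : 0 ≤ η)
    (r : Fin T) (p p' : Fin T → (Fin T → X) → J → ℝ) (hp : ∀ t xs j, 0 ≤ p t xs j)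
    (hp' : ∀ t xs j, 0 ≤ p' t xs j) (hdep : ∀ t, DependsBefore t (p t))
    (hdep' : ∀ t, DependsBefore t (p' t)) (hp1 : ∀ t xs, ∑ j, p t xs j = 1)
    (hp1' : ∀ t xs, ∑ j, p' t xs j = 1) (g g' : Fin T → J → X → ℝ)
    (hpp : ∀ t, t ≠ r → p t = p' t) (hg : ∀ t, t ≠ r → g t = g' t)
    (hgr : ∀ j i x, |g r j x - g' r i x| ≤ 1 / 2) (a : J) (hga : ∀ j, j ≠ a → g r j = g' r j)
    (β : ℝ) (hβ : ∀ xs, 1 - ∑ j ∈ Finset.univ.erase a, min (p r xs j) (p' r xs j) ≤ β)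
    (φ : (Fin T → X) → ℝ) (hφ : ∀ xs, 0 ≤ φ xs) (hφ1 : ∀ xs, φ xs ≤ 1) {l u : ℝ} (hl : 0 ≤ l)
    (hu : 0 ≤ u) :
    ∑ xs, φ xs * mixture η p g xs ≤ (1 + β * (Real.exp u - 1)) * ∑ xs, φ xs * mixture η p' g' xs +
      β * Real.exp (-(l * u) + T * (l * (l + 1) * η ^ 2 / 8)) := by
  have : Nonempty J := ⟨a⟩
  set κ := Real.exp (-(l * u) + T * (l * (l + 1) * η ^ 2 / 8))
  -- The common part avoids `a`, hence contributes equally under both losses; the residuals `ρ` and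
  -- `ρ'` have the same mass `b ≤ β`.
  set m : (Fin T → X) → J → ℝ := fun xs j => if j = a then 0 else min (p r xs j) (p' r xs j) with hm
  set ρ : (Fin T → X) → J → ℝ := fun xs j => p r xs j - m xs j with hρ
  set ρ' : (Fin T → X) → J → ℝ := fun xs j => p' r xs j - m xs j with hρ'
  set b : (Fin T → X) → ℝ := fun xs => 1 - ∑ j, m xs j with hb
  have hmdep : DependsBefore r m := fun xs xs' h => by
    simp only [hm, hdep r xs xs' h, hdep' r xs xs' h]
  have hρdep : DependsBefore r ρ := fun xs xs' h => by
    simp only [hρ, hdep r xs xs' h, hmdep xs xs' h]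
  have hρdep' : DependsBefore r ρ' := fun xs xs' h => by
    simp only [hρ', hdep' r xs xs' h, hmdep xs xs' h]
  have hbdep : DependsBefore r b := fun xs xs' h => by
    simp only [hb, hmdep xs xs' h]
  have hρ0 : ∀ xs j, 0 ≤ ρ xs j := by
    intro xs j
    simp only [hρ, hm, sub_nonneg]
    split_ifs
    exacts [hp _ _ _, min_le_left _ _]
  have hρ0' : ∀ xs j, 0 ≤ ρ' xs j := by
    intro xs j
    simp only [hρ', hm, sub_nonneg]
    split_ifs
    exacts [hp' _ _ _, min_le_right _ _]
  have hρsum : ∀ xs, ∑ j, ρ xs j = b xs := fun xs => by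
    simp only [hρ, hb, Finset.sum_sub_distrib, hp1]
  have hρsum' : ∀ xs, ∑ j, ρ' xs j = b xs := fun xs => by
    simp only [hρ', hb, Finset.sum_sub_distrib, hp1']
  have hb0 : ∀ xs, 0 ≤ b xs := fun xs => by
    rw [← hρsum]
    exact Finset.sum_nonneg fun j _ => hρ0 xs j
  have hbβ : ∀ xs, b xs ≤ β := by
    intro xs
    refine le_trans (le_of_eq ?_) (hβ xs)
    simp only [hb]
    rw [← Finset.add_sum_erase _ _ (Finset.mem_univ a)]
    simp only [hm, if_true, zero_add]
    congr 1
    exact Finset.sum_congr rfl fun j hj => by rw [if_neg (Finset.ne_of_mem_erase hj)]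
  -- When `b xs = 0` the residuals vanish, so the coupling `ρ ρ' / b` still has the right marginals
  -- under division by zero.
  have hρzero : ∀ xs j, b xs = 0 → ρ xs j = 0 := fun xs j h =>
    (Finset.sum_eq_zero_iff_of_nonneg fun j _ => hρ0 xs j).1 ((hρsum xs).trans h) j
      (Finset.mem_univ j)
  have hρzero' : ∀ xs j, b xs = 0 → ρ' xs j = 0 := fun xs j h =>
    (Finset.sum_eq_zero_iff_of_nonneg fun j _ => hρ0' xs j).1 ((hρsum' xs).trans h) j
      (Finset.mem_univ j)
  have hupd : ∀ v, Function.update p r v = Function.update p' r v := by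
    intro v
    funext t
    rcases eq_or_ne t r with rfl | ht
    · simp
    · simp [ht, hpp t ht]
  have hC : ∀ xs, mixture η (Function.update p r m) g xs =
      mixture η (Function.update p r m) g' xs := by
    intro xs
    refine mixture_congr η fun t j => ⟨rfl, fun h => ?_⟩
    rcases eq_or_ne t r with rfl | ht
    · refine hga j fun hj => h ?_
      simp [hm, hj]
    · rw [hg t ht]
  have hsplit : ∀ xs, mixture η p g xs = mixture η (Function.update p r m) g xs +
      mixture η (Function.update p r ρ) g xs := by
    intro xs
    rw [← mixture_update_add]
    have : m + ρ = p r := by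
      funext xs j
      simp [hρ]
    rw [this, Function.update_eq_self]
  have hsplit' : ∀ xs, mixture η p' g' xs = mixture η (Function.update p r m) g' xs +
      mixture η (Function.update p r ρ') g' xs := by
    intro xs
    rw [← mixture_update_add, hupd]
    have : m + ρ' = p' r := by
      funext xs j
      simp [hρ']
    rw [this, Function.update_eq_self]
  have hG0 : ∀ xs, 0 ≤ mixture η p' g' xs := fun xs =>
    mixture_nonneg η p' g' xs fun t y => hp' t xs y
  -- Two comparisons of the residual `ρ`: here with `ρ'`, and in `h2` with the whole law `p' r`
  -- scaled by `b`.
  have h1 := sum_mul_mixture_update_le hη r p hp hdep hp1 (fun xs j i => ρ xs j * ρ' xs i / b xs)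
    (fun xs j i => div_nonneg (mul_nonneg (hρ0 _ _) (hρ0' _ _)) (hb0 _))
    (fun xs xs' h => by simp only [hρdep xs xs' h, hρdep' xs xs' h, hbdep xs xs' h]) β
    (fun xs => by
      simp_rw [← Finset.sum_div, ← Finset.mul_sum, ← Finset.sum_mul, hρsum, hρsum']
      rw [mul_self_div_self]
      exact hbβ xs) g g' hg hgr φ hφ hφ1 hl u
  have h2 := sum_mul_mixture_update_le hη r p hp hdep hp1 (fun xs j i => ρ xs j * p' r xs i)
    (fun xs j i => mul_nonneg (hρ0 _ _) (hp' _ _ _))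
    (fun xs xs' h => by simp only [hρdep xs xs' h, hdep' r xs xs' h]) β
    (fun xs => by
      simp_rw [← Finset.mul_sum, ← Finset.sum_mul, hρsum, hp1', mul_one]
      exact hbβ xs) g g' hg hgr φ hφ hφ1 hl u
  have e1 : (fun xs j => ∑ i, ρ xs j * ρ' xs i / b xs) = ρ := by
    funext xs j
    rw [← Finset.sum_div, ← Finset.mul_sum, hρsum']
    rcases eq_or_ne (b xs) 0 with h | h
    · simp [h, hρzero xs j h]
    · field_simp
  have e2 : (fun xs i => ∑ j, ρ xs j * ρ' xs i / b xs) = ρ' := by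
    funext xs j
    rw [← Finset.sum_div, ← Finset.sum_mul, hρsum]
    rcases eq_or_ne (b xs) 0 with h | h
    · simp [h, hρzero' xs j h]
    · field_simp
  have e3 : (fun xs j => ∑ i, ρ xs j * p' r xs i) = ρ := by
    funext xs j
    rw [← Finset.mul_sum, hp1', mul_one]
  have e4 : (fun xs i => ∑ j, ρ xs j * p' r xs i) = fun xs i => b xs * p' r xs i := by
    funext xs j
    rw [← Finset.sum_mul, hρsum]
  rw [e1, e2] at h1
  rw [e3, e4] at h2
  have h3 : ∀ xs, mixture η (Function.update p r fun xs i => b xs * p' r xs i) g' xs =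
      b xs * mixture η p' g' xs := by
    intro xs
    rw [mixture_update_mul, hupd, Function.update_eq_self]
  have h4 : ∑ xs, φ xs * (b xs * mixture η p' g' xs) ≤ β * ∑ xs, φ xs * mixture η p' g' xs := by
    rw [Finset.mul_sum]
    refine Finset.sum_le_sum fun xs _ => ?_
    have := mul_le_mul_of_nonneg_right (hbβ xs) (mul_nonneg (hφ xs) (hG0 xs))
    linarith
  simp_rw [h3] at h2
  set A := ∑ xs, φ xs * mixture η (Function.update p r ρ) g xs
  set A' := ∑ xs, φ xs * mixture η (Function.update p r ρ') g' xs
  set G' := ∑ xs, φ xs * mixture η p' g' xs with hG'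
  have hdiff : ∑ xs, φ xs * mixture η p g xs = G' + A - A' := by
    simp_rw [hG', hsplit, hsplit', hC, mul_add, Finset.sum_add_distrib]
    ring
  have hE : 1 ≤ Real.exp u := Real.one_le_exp hu
  have h5 : A ≤ Real.exp u * (β * G') + β * κ :=
    h2.trans (by gcongr)
  -- Write `exp u * (A - A') = (exp u - 1) * A + (A - exp u * A')`; `h5` bounds the first term and
  -- `h1` the second. This is where the excess factor shrinks by `β`.
  have h6 : Real.exp u * (A - A') ≤ Real.exp u * (β * (Real.exp u - 1) * G' + β * κ) := by
    have := mul_le_mul_of_nonneg_left h5 (sub_nonneg.2 hE)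
    nlinarith
  have h7 := le_of_mul_le_mul_left h6 (Real.exp_pos u)
  rw [hdiff]
  linarith

end Exchange

/-! ### Hybrid argument over the rounds -/

section Hybrid

variable {X J : Type*} [Fintype X] [Fintype J] {T : ℕ}

/-- Changing the token distributions and the losses in all rounds, one round after the other. -/
theorem sum_mul_mixture_le_pow [Nonempty X] [DecidableEq J] {η : ℝ} (hη : 0 ≤ η)
    (p p' : Fin T → (Fin T → X) → J → ℝ) (hp : ∀ t xs j, 0 ≤ p t xs j)
    (hp' : ∀ t xs j, 0 ≤ p' t xs j) (hdep : ∀ t, DependsBefore t (p t))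
    (hdep' : ∀ t, DependsBefore t (p' t)) (hp1 : ∀ t xs, ∑ j, p t xs j = 1)
    (hp1' : ∀ t xs, ∑ j, p' t xs j = 1) (g g' : J → X → ℝ)
    (hg : ∀ j i x, |g j x - g' i x| ≤ 1 / 2) (a : J) (hga : ∀ j, j ≠ a → g j = g' j)
    {β : ℝ} (hβ0 : 0 ≤ β)
    (hβ : ∀ t xs, 1 - ∑ j ∈ Finset.univ.erase a, min (p t xs j) (p' t xs j) ≤ β)
    (φ : (Fin T → X) → ℝ) (hφ : ∀ xs, 0 ≤ φ xs) (hφ1 : ∀ xs, φ xs ≤ 1) {l u : ℝ} (hl : 0 ≤ l)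
    (hu : 0 ≤ u) :
    ∑ xs, φ xs * mixture η p (fun _ => g) xs ≤
      (1 + β * (Real.exp u - 1)) ^ T * (∑ xs, φ xs * mixture η p' (fun _ => g') xs +
        T * (β * Real.exp (-(l * u) + T * (l * (l + 1) * η ^ 2 / 8)))) := by
  set κ := Real.exp (-(l * u) + T * (l * (l + 1) * η ^ 2 / 8)) with hκ
  set c := 1 + β * (Real.exp u - 1) with hc
  have hc1 : 1 ≤ c := by
    have := mul_nonneg hβ0 (sub_nonneg.2 (Real.one_le_exp hu))
    linarith
  -- Hybrid `k` plays the first `k` rounds with the new profile. Sampling laws are functions of the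
  -- transcript alone, so rounds can be switched independently.
  set P : ℕ → Fin T → (Fin T → X) → J → ℝ := fun k t => if (t : ℕ) < k then p' t else p t with hP
  set G : ℕ → Fin T → J → X → ℝ := fun k t => if (t : ℕ) < k then g' else g with hG
  have hstep : ∀ k < T, ∑ xs, φ xs * mixture η (P k) (G k) xs ≤
      c * ∑ xs, φ xs * mixture η (P (k + 1)) (G (k + 1)) xs + β * κ := by
    intro k hk
    have hne : ∀ t : Fin T, t ≠ ⟨k, hk⟩ → ((t : ℕ) < k ↔ (t : ℕ) < k + 1) := by
      intro t ht
      have : (t : ℕ) ≠ k := fun h => ht (Fin.ext h)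
      omega
    refine sum_mul_mixture_exchange_le hη ⟨k, hk⟩ (P k) (P (k + 1)) ?_ ?_ ?_ ?_ ?_ ?_ (G k)
      (G (k + 1)) ?_ ?_ ?_ a ?_ β ?_ φ hφ hφ1 hl hu
    · intro t xs j
      simp only [hP]
      split_ifs
      exacts [hp' _ _ _, hp _ _ _]
    · intro t xs j
      simp only [hP]
      split_ifs
      exacts [hp' _ _ _, hp _ _ _]
    · intro t
      simp only [hP]
      split_ifs
      exacts [hdep' _, hdep _]
    · intro t
      simp only [hP]
      split_ifs
      exacts [hdep' _, hdep _]
    · intro t xs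
      simp only [hP]
      split_ifs
      exacts [hp1' _ _, hp1 _ _]
    · intro t xs
      simp only [hP]
      split_ifs
      exacts [hp1' _ _, hp1 _ _]
    · intro t ht
      simp only [hP, hne t ht]
    · intro t ht
      simp only [hG, hne t ht]
    · simpa [hG] using hg
    · simpa [hG] using hga
    · simpa [hP] using hβ ⟨k, hk⟩
  have hind : ∀ k ≤ T, ∑ xs, φ xs * mixture η (P 0) (G 0) xs ≤
      c ^ k * (∑ xs, φ xs * mixture η (P k) (G k) xs + k * (β * κ)) := by
    intro k
    induction k with
    | zero => simp
    | succ k ih =>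
      intro hk
      refine (ih (by omega)).trans ?_
      have hκ0 : 0 ≤ β * κ := mul_nonneg hβ0 (Real.exp_pos _).le
      have h1 : (k : ℝ) * (β * κ) + β * κ ≤ c * ((k + 1) * (β * κ)) := by
        have := le_mul_of_one_le_left (a := c) (b := ((k : ℝ) + 1) * (β * κ)) (by positivity) hc1
        linarith
      rw [pow_succ, mul_assoc]
      push_cast
      refine mul_le_mul_of_nonneg_left ?_ (pow_nonneg (by linarith) _)
      rw [mul_add]
      linarith [hstep k (by omega)]
  have h := hind T le_rfl
  have e0 : P 0 = p := by funext t; simp [hP]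
  have eT : P T = p' := by funext t; simp [hP]
  have f0 : G 0 = fun _ => g := by funext t; simp [hG]
  have fT : G T = fun _ => g' := by funext t; simp [hG]
  rwa [e0, eT, f0, fT] at h

end Hybrid

/-! ### The analyst player -/

section Analyst

variable {X A : Type*} [Fintype A]

/-- Intermediate value theorem: at `c = 1` the clipped sum is at most `s`, and once `c` exceeds
every `1 / w a` all terms are clipped and the sum is `|A| ≥ s`. -/
theorem exists_proj_eq {s : ℝ} {w : A → ℝ} (hw : ∀ a, 0 < w a) (hws : ∑ a, w a ≤ s)
    (hs : s ≤ Fintype.card A) :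
    ∃ c : ℝ, ∑ a, min 1 (c * w a) = s ∧ proj s w = fun a => min 1 (c * w a) := by
  have hex : ∃ c : ℝ, 1 ≤ c ∧ ∑ a, min 1 (c * w a) = s := by
    obtain ⟨C, hC1, hC⟩ : ∃ C : ℝ, 1 ≤ C ∧ ∀ a, 1 ≤ C * w a := by
      refine ⟨1 + ∑ a, (w a)⁻¹, ?_, fun a => ?_⟩
      · have : 0 ≤ ∑ a, (w a)⁻¹ := Finset.sum_nonneg fun a _ => (inv_pos.2 (hw a)).le
        linarith
      · have h1 : (w a)⁻¹ ≤ ∑ a, (w a)⁻¹ :=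
          Finset.single_le_sum (f := fun a => (w a)⁻¹) (fun a _ => (inv_pos.2 (hw a)).le)
            (Finset.mem_univ a)
        calc (1 : ℝ) = (w a)⁻¹ * w a := (inv_mul_cancel₀ (hw a).ne').symm
          _ ≤ _ := mul_le_mul_of_nonneg_right (by linarith) (hw a).le
    have hcont : ContinuousOn (fun c : ℝ => ∑ a, min 1 (c * w a)) (Set.Icc 1 C) := by fun_prop
    have h1 : ∑ a, min 1 (1 * w a) ≤ s :=
      (Finset.sum_le_sum fun a _ => by simp).trans hws
    have h2 : s ≤ ∑ a, min 1 (C * w a) := by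
      simpa [hC] using hs
    obtain ⟨c, hc, hcs⟩ := intermediate_value_Icc hC1 hcont ⟨h1, h2⟩
    exact ⟨c, hc.1, hcs⟩
  refine ⟨hex.choose, hex.choose_spec.2, ?_⟩
  rw [proj, dif_pos hex]

theorem exists_normalize_proj_eq {s : ℝ} {w : A → ℝ} (hw : ∀ a, 0 < w a) (hws : ∑ a, w a ≤ s)
    (hs : s ≤ Fintype.card A) :
    ∃ c : ℝ, ∑ a, min 1 (c * w a) = s ∧
      ∀ a, normalize (proj s w) a = min 1 (c * w a) / s := by
  obtain ⟨c, hc, hproj⟩ := exists_proj_eq hw hws hs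
  refine ⟨c, hc, fun a => ?_⟩
  rw [normalize, hproj, hc]

theorem sum_normalize_proj {s : ℝ} (hs0 : 0 < s) {w : A → ℝ} (hw : ∀ a, 0 < w a)
    (hws : ∑ a, w a ≤ s) (hs : s ≤ Fintype.card A) : ∑ a, normalize (proj s w) a = 1 := by
  obtain ⟨c, hc, h⟩ := exists_normalize_proj_eq hw hws hs
  simp_rw [h, ← Finset.sum_div, hc]
  exact div_self hs0.ne'

theorem proj_nonneg {s : ℝ} {w : A → ℝ} (hw : ∀ a, 0 < w a) (a : A) : 0 ≤ proj s w a := by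
  unfold proj
  split_ifs with h
  · exact le_min zero_le_one (mul_nonneg (zero_le_one.trans h.choose_spec.1) (hw a).le)
  · exact (hw a).le

theorem normalize_proj_nonneg {s : ℝ} {w : A → ℝ} (hw : ∀ a, 0 < w a) (a : A) :
    0 ≤ normalize (proj s w) a :=
  div_nonneg (proj_nonneg hw a) (Finset.sum_nonneg fun b _ => proj_nonneg hw b)

/-- The projections of two measures that agree off `a` overlap, off `a`, up to mass `1 / s`. -/
theorem one_sub_sum_min_normalize_proj_le [DecidableEq A] {s : ℝ} (hs0 : 0 < s) {w w' : A → ℝ}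
    (hw : ∀ a, 0 < w a) (hws : ∑ a, w a ≤ s) (hw' : ∀ a, 0 < w' a) (hws' : ∑ a, w' a ≤ s)
    (hs : s ≤ Fintype.card A) (a : A) (ha : ∀ j, j ≠ a → w j = w' j) :
    1 - ∑ j ∈ Finset.univ.erase a, min (normalize (proj s w) j) (normalize (proj s w') j) ≤
      1 / s := by
  obtain ⟨c, hc, h⟩ := exists_normalize_proj_eq hw hws hs
  obtain ⟨c', hc', h'⟩ := exists_normalize_proj_eq hw' hws' hs
  -- Removing `a` loses at most `1 / s`, by clipping. Off `a` the measures agree, so the projection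
  -- with the smaller constant is the pointwise minimum.
  have key : ∀ (c₀ : ℝ) (v : A → ℝ), ∑ j, min 1 (c₀ * v j) = s →
      1 - ∑ j ∈ Finset.univ.erase a, min 1 (c₀ * v j) / s ≤ 1 / s := by
    intro c₀ v hv
    rw [← Finset.add_sum_erase _ _ (Finset.mem_univ a)] at hv
    rw [← Finset.sum_div, sub_le_iff_le_add, ← add_div, le_div_iff₀ hs0]
    linarith [min_le_left 1 (c₀ * v a)]
  rcases le_total c c' with hcc | hcc
  · rw [Finset.sum_congr rfl fun j hj => ?_]
    · exact key c w hc
    · rw [h, h', ← ha j (Finset.ne_of_mem_erase hj)]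
      have := (hw j).le
      exact min_eq_left (by gcongr)
  · rw [Finset.sum_congr rfl fun j hj => ?_]
    · exact key c' w' hc'
    · rw [h, h', ha j (Finset.ne_of_mem_erase hj)]
      have := (hw' j).le
      exact min_eq_right (by gcongr)

end Analyst

/-! ### Losses -/

section Loss

variable {X : Type*} {n : ℕ}

theorem eval_le_one (q : LinearQuery X) (D : Fin n → X) : q.eval D ≤ 1 := by
  have h : ∑ i, (q (D i) : ℝ) ≤ n := by
    simpa using Finset.sum_le_sum fun i (_ : i ∈ Finset.univ) => (q (D i)).2.2
  unfold LinearQuery.eval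
  rw [one_div_mul_eq_div]
  exact div_le_one_of_le₀ h (by positivity)

theorem eval_neg (hn : 0 < n) (q : LinearQuery X) (D : Fin n → X) :
    q.neg.eval D = 1 - q.eval D := by
  have : (n : ℝ) ≠ 0 := by positivity
  simp [LinearQuery.eval, LinearQuery.neg, mul_sub, this]

theorem neg_mem_closeNeg {Q : Finset (LinearQuery X)} {q : LinearQuery X} (hq : q ∈ closeNeg Q) :
    q.neg ∈ closeNeg Q := by
  classical
  unfold closeNeg at hq ⊢
  rcases Finset.mem_union.1 hq with h | h
  · exact Finset.mem_union_right _ (Finset.mem_image_of_mem _ h)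
  · obtain ⟨q', h', rfl⟩ := Finset.mem_image.1 h
    have : q'.neg.neg = q' := by
      funext x
      simp [LinearQuery.neg]
    rw [this]
    exact Finset.mem_union_left _ h'

/-- The terms of `q` and of its negation add up to `1`, so one of them is at least `1/2`. This
halves the range of the losses. -/
theorem half_le_loss (hn : 0 < n) (D : Fin n → X) (Q : Finset (LinearQuery X)) (x : X) :
    1 / 2 ≤ loss D (closeNeg Q) x := by
  unfold loss
  split_ifs with h
  · obtain ⟨q, hq⟩ := h
    have h1 := Finset.le_sup' (fun q => (1 + q.eval D - (q x : ℝ)) / 2) hq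
    have h2 := Finset.le_sup' (fun q => (1 + q.eval D - (q x : ℝ)) / 2) (neg_mem_closeNeg hq)
    simp only [eval_neg hn, LinearQuery.neg, unitInterval.coe_symm_eq] at h1 h2
    linarith
  · exact le_rfl

theorem loss_le_one (D : Fin n → X) (Q : Finset (LinearQuery X)) (x : X) : loss D Q x ≤ 1 := by
  unfold loss
  split_ifs with h
  · refine Finset.sup'_le _ _ fun q _ => ?_
    linarith [eval_le_one q D, (q x).2.1]
  · norm_num

end Loss

/-! ### Privacy of the synthetic database -/

section Transcript

variable {X : Type*} {n m T : ℕ}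

theorem analystMeasure_pos (hm : 0 < m) (η : ℝ) (D : Fin n → X)
    (Q : Fin m → Finset (LinearQuery X)) (xs : Fin T → X) (t : Fin T) (i : Fin m) :
    0 < analystMeasure η D Q xs t i :=
  mul_pos (by positivity) (Finset.prod_pos fun _ _ => Real.exp_pos _)

theorem sum_analystMeasure_le_one {η : ℝ} (hη : 0 ≤ η) (D : Fin n → X)
    (Q : Fin m → Finset (LinearQuery X)) (hQ : ∀ i x, 0 ≤ loss D (Q i) x) (xs : Fin T → X)
    (t : Fin T) : ∑ i, analystMeasure η D Q xs t i ≤ 1 := by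
  have h : ∀ i, analystMeasure η D Q xs t i ≤ 1 / m := fun i =>
    mul_le_of_le_one_right (by positivity) (Finset.prod_le_one (fun _ _ => (Real.exp_pos _).le)
      fun j _ => Real.exp_le_one_iff.2 (by nlinarith [mul_nonneg hη (hQ i (xs j))]))
  refine (Finset.sum_le_sum fun i _ => h i).trans ?_
  rw [Finset.sum_const, Finset.card_univ, Fintype.card_fin, nsmul_eq_mul, mul_one_div]
  exact div_self_le_one _

theorem dependsBefore_analystMeasure (η : ℝ) (D : Fin n → X)
    (Q : Fin m → Finset (LinearQuery X)) (t : Fin T) :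
    DependsBefore t fun xs => analystMeasure η D Q xs t := by
  intro xs xs' h
  funext i
  unfold analystMeasure
  refine congrArg _ ?_
  exact Finset.prod_congr rfl fun j hj => by rw [h j (Finset.mem_Iio.1 hj)]

theorem normalize_dataMeasure [Fintype X] [Nonempty X] (η : ℝ) (D : Fin n → X)
    (Q : Fin m → Finset (LinearQuery X)) (ids : Fin T → Fin m) (t : Fin T) :
    normalize (dataMeasure η D Q ids t) = gibbs (logWeight η (fun _ i => loss D (Q i)) ids t) := by
  funext x
  have h : ∀ y, dataMeasure η D Q ids t y = (1 / (Fintype.card X : ℝ)) *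
      Real.exp (logWeight η (fun _ i => loss D (Q i)) ids t y) := by
    intro y
    rw [dataMeasure, logWeight, Finset.mul_sum, Real.exp_sum]
  have hX : (1 / (Fintype.card X : ℝ)) ≠ 0 := by
    have : 0 < Fintype.card X := Fintype.card_pos
    positivity
  simp_rw [normalize, gibbs, h, ← Finset.mul_sum]
  exact mul_div_mul_left _ _ hX

theorem transcriptProb_eq_mixture [Fintype X] [Nonempty X] (η s : ℝ) (D : Fin n → X)
    (Q : Fin m → Finset (LinearQuery X)) (xs : Fin T → X) :
    transcriptProb η s D Q xs =
      mixture η (fun t xs => normalize (proj s (analystMeasure η D Q xs t)))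
        (fun _ i => loss D (Q i)) xs := by
  simp_rw [transcriptProb, mixture, normalize_dataMeasure]

theorem transcriptProb_nonneg [Fintype X] [Nonempty X] (hm : 0 < m) (η s : ℝ) (D : Fin n → X)
    (Q : Fin m → Finset (LinearQuery X)) (xs : Fin T → X) : 0 ≤ transcriptProb η s D Q xs := by
  rw [transcriptProb_eq_mixture]
  exact mixture_nonneg _ _ _ _ fun t y =>
    normalize_proj_nonneg (analystMeasure_pos hm η D Q xs t) y

/-- The synthetic database is private with respect to a change of one analyst's queries. -/
theorem sum_mul_transcriptProb_le [Fintype X] [Nonempty X] (hn : 0 < n) (hT : 0 < T)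
    (hTm : 12 * T ≤ m) {ε δ : ℝ} (hε : 0 < ε) (hε1 : ε ≤ 1) (hδ : 0 < δ) (hδ1 : δ < 1)
    (D : Fin n → X) (Q Q' : Fin m → Finset (LinearQuery X)) (a : Fin m)
    (hQ : ∀ j, j ≠ a → Q j = Q' j) (φ : (Fin T → X) → ℝ) (hφ : ∀ xs, 0 ≤ φ xs)
    (hφ1 : ∀ xs, φ xs ≤ 1) :
    ∑ xs, φ xs * transcriptProb (ε / (2 * √(T * Real.log (1 / δ)))) (12 * T) D
        (fun i => closeNeg (Q i)) xs ≤
      Real.exp ε * ∑ xs, φ xs * transcriptProb (ε / (2 * √(T * Real.log (1 / δ)))) (12 * T) D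
        (fun i => closeNeg (Q' i)) xs + δ := by
  set L := Real.log (1 / δ) with hL
  have hL0 : 0 < L := Real.log_pos (by rw [lt_div_iff₀ hδ]; linarith)
  have hT0 : (0 : ℝ) < T := by exact_mod_cast hT
  set η := ε / (2 * √(T * L)) with hη
  have hη0 : 0 ≤ η := by positivity
  have hη2 : η ^ 2 = ε ^ 2 / (4 * (T * L)) := by
    rw [hη, div_pow, mul_pow, Real.sq_sqrt (by positivity)]
    norm_num
  have hm : 0 < m := by omega
  set s : ℝ := 12 * T with hs
  have hs0 : 0 < s := by positivity
  have hs1 : 1 ≤ s := by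
    have : (1 : ℝ) ≤ T := by exact_mod_cast hT
    linarith
  have hsm : s ≤ Fintype.card (Fin m) := by
    rw [Fintype.card_fin, hs]
    exact_mod_cast hTm
  have hloss : ∀ (R : Finset (LinearQuery X)) x, 0 ≤ loss D (closeNeg R) x := fun R x =>
    le_trans (by norm_num) (half_le_loss hn D R x)
  have hw := fun Q : Fin m → Finset (LinearQuery X) =>
    analystMeasure_pos (T := T) hm η D fun i => closeNeg (Q i)
  have hws : ∀ (Q : Fin m → Finset (LinearQuery X)) (xs : Fin T → X) (t : Fin T),
      ∑ i, analystMeasure η D (fun i => closeNeg (Q i)) xs t i ≤ s := fun Q xs t =>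
    (sum_analystMeasure_le_one hη0 D _ (fun i x => hloss _ x) xs t).trans hs1
  have key := sum_mul_mixture_le_pow hη0
    (fun t xs => normalize (proj s (analystMeasure η D (fun i => closeNeg (Q i)) xs t)))
    (fun t xs => normalize (proj s (analystMeasure η D (fun i => closeNeg (Q' i)) xs t)))
    (fun t xs j => normalize_proj_nonneg (hw Q xs t) j)
    (fun t xs j => normalize_proj_nonneg (hw Q' xs t) j)
    (fun t xs xs' h => congrArg (fun w => normalize (proj s w))
      (dependsBefore_analystMeasure η D (fun i => closeNeg (Q i)) t xs xs' h))
    (fun t xs xs' h => congrArg (fun w => normalize (proj s w))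
      (dependsBefore_analystMeasure η D (fun i => closeNeg (Q' i)) t xs xs' h))
    (fun t xs => sum_normalize_proj hs0 (hw Q xs t) (hws Q xs t) hsm)
    (fun t xs => sum_normalize_proj hs0 (hw Q' xs t) (hws Q' xs t) hsm)
    (fun i => loss D (closeNeg (Q i))) (fun i => loss D (closeNeg (Q' i)))
    (fun j i x => by
      rw [abs_le]
      constructor <;> linarith [half_le_loss hn D (Q j) x, half_le_loss hn D (Q' i) x,
        loss_le_one D (closeNeg (Q j)) x, loss_le_one D (closeNeg (Q' i)) x])
    a (fun j hj => by rw [hQ j hj]) (β := 1 / s) (by positivity)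
    (fun t xs => one_sub_sum_min_normalize_proj_le hs0 (hw Q xs t) (hws Q xs t) (hw Q' xs t)
      (hws Q' xs t) hsm a fun j hj => by simp only [analystMeasure, hQ j hj])
    -- With this order `l`, the Markov factor `exp (-(l * u))` is `exp (-2 * L) = δ ^ 2`.
    φ hφ hφ1 (l := 2 * L / ε) (u := ε) (by positivity) hε.le
  simp_rw [transcriptProb_eq_mixture]
  refine key.trans ?_
  rw [mul_add]
  have hE1 : Real.exp ε - 1 ≤ 2 * ε := by
    have := Real.abs_exp_sub_one_le (x := ε) (by rwa [abs_of_pos hε])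
    rw [abs_of_pos hε] at this
    exact (le_abs_self _).trans this
  have hE0 : 0 ≤ Real.exp ε - 1 := sub_nonneg.2 (Real.one_le_exp hε.le)
  have hpow : (1 + 1 / s * (Real.exp ε - 1)) ^ T ≤ Real.exp ε := by
    calc (1 + 1 / s * (Real.exp ε - 1)) ^ T ≤ (Real.exp (1 / s * (Real.exp ε - 1))) ^ T := by
          gcongr
          rw [add_comm]
          exact Real.add_one_le_exp _
      _ = Real.exp ((Real.exp ε - 1) / 12) := by
          rw [← Real.exp_nat_mul, hs]
          congr 1
          field_simp
      _ ≤ _ := Real.exp_le_exp.2 (by linarith)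
  have hG0 : 0 ≤ ∑ xs, φ xs * mixture η
      (fun t xs => normalize (proj s (analystMeasure η D (fun i => closeNeg (Q' i)) xs t)))
      (fun _ i => loss D (closeNeg (Q' i))) xs :=
    Finset.sum_nonneg fun xs _ => mul_nonneg (hφ xs) <| mixture_nonneg _ _ _ _ fun t y =>
      normalize_proj_nonneg (hw Q' xs t) y
  -- The choice of `η` makes the Rényi term equal to `(2 * L + ε) / 16`, at most `L + 1`.
  have hκ : Real.exp (-(2 * L / ε * ε) + T * (2 * L / ε * (2 * L / ε + 1) * η ^ 2 / 8)) ≤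
      δ * Real.exp 1 := by
    have e : -(2 * L / ε * ε) + T * (2 * L / ε * (2 * L / ε + 1) * η ^ 2 / 8) =
        -2 * L + (2 * L + ε) / 16 := by
      rw [hη2]
      field_simp
      ring
    have hδL : δ = Real.exp (-L) := by
      rw [hL, one_div, Real.log_inv, neg_neg, Real.exp_log hδ]
    rw [e, hδL, ← Real.exp_add]
    exact Real.exp_le_exp.2 (by linarith)
  -- Since `T / s = 1 / 12`, the accumulated error is at most `exp 2 / 12 * δ`, and `exp 2 < 12`.
  have htail : (1 + 1 / s * (Real.exp ε - 1)) ^ T * (T * (1 / s * Real.exp (-(2 * L / ε * ε) +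
      T * (2 * L / ε * (2 * L / ε + 1) * η ^ 2 / 8)))) ≤ δ := by
    calc _ ≤ Real.exp 1 * (T * (1 / s * (δ * Real.exp 1))) := by
          gcongr
          exact hpow.trans (Real.exp_le_exp.2 hε1)
      _ = (Real.exp 1 * Real.exp 1 / 12) * δ := by
          rw [hs]
          field_simp
      _ ≤ 1 * δ := by
          gcongr
          nlinarith [Real.exp_one_lt_d9, Real.exp_pos 1]
      _ = δ := one_mul δ
  exact add_le_add (mul_le_mul_of_nonneg_right hpow hG0) htail

end Transcript

/-! ### Outputs to the other analysts -/

theorem map_pi_subtype_eq {ι : Type*} [Fintype ι] [DecidableEq ι] {O : ι → Type*}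
    [∀ i, MeasurableSpace (O i)]
    (μ : ∀ i, Measure (O i)) [∀ i, IsProbabilityMeasure (μ i)] (p : ι → Prop) [DecidablePred p] :
    (Measure.pi μ).map (fun z (j : {j // p j}) => z j.1) =
      Measure.pi fun j : {j // p j} => μ j.1 := by
  have h := (measurePreserving_piEquivPiSubtypeProd μ p).map_eq
  have h2 := congrArg (fun ν => ν.map Prod.fst) h
  rw [Measure.map_map measurable_fst (MeasurableEquiv.measurable _), Measure.map_fst_prod,
    measure_univ, one_smul] at h2
  exact h2

theorem measurableSet_sparseVectorSelect_eq {m : ℕ} (α : ℝ) (f : Fin m → ℝ) (I : Finset (Fin m)) :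
    MeasurableSet {p : ℝ × (Fin m → ℝ) | sparseVectorSelect α f p.1 p.2 = I} := by
  have h : {p : ℝ × (Fin m → ℝ) | sparseVectorSelect α f p.1 p.2 = I} =
      ⋂ i, {p | (α ≤ f i ∧ p.1 ≤ f i + p.2 i) ↔ i ∈ I} := by
    ext p
    simp [sparseVectorSelect, Finset.ext_iff]
  rw [h]
  refine MeasurableSet.iInter fun i => ?_
  have h1 : MeasurableSet {p : ℝ × (Fin m → ℝ) | α ≤ f i ∧ p.1 ≤ f i + p.2 i} :=
    (MeasurableSet.const _).inter
      (measurableSet_le measurable_fst (((measurable_pi_apply i).comp measurable_snd).const_add _))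
  by_cases hi : i ∈ I
  · simpa [hi] using h1
  · simp only [hi, iff_false]
    exact h1.compl

/-- Returns to the underlying noise, so that two value vectors can be compared under the same
threshold and noise. -/
theorem sum_sparseVectorProb_mul {m : ℕ} (α : ℝ) (thr noise : ProbabilityMeasure ℝ)
    (f : Fin m → ℝ) (h : Finset (Fin m) → ENNReal) :
    ∑ I, sparseVectorProb α thr noise f I * h I =
      ∫⁻ p, h (sparseVectorSelect α f p.1 p.2)
        ∂((thr : Measure ℝ).prod (Measure.pi fun _ : Fin m => (noise : Measure ℝ))) := by
  classical
  have e : ∀ p : ℝ × (Fin m → ℝ), h (sparseVectorSelect α f p.1 p.2) =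
      ∑ I, {p : ℝ × (Fin m → ℝ) | sparseVectorSelect α f p.1 p.2 = I}.indicator
        (fun _ => h I) p := by
    intro p
    simp [Set.indicator_apply]
  simp_rw [e]
  rw [lintegral_finsetSum _ fun I _ =>
    measurable_const.indicator (measurableSet_sparseVectorSelect_eq α f I)]
  refine Finset.sum_congr rfl fun I _ => ?_
  rw [lintegral_indicator_const (measurableSet_sparseVectorSelect_eq α f I), mul_comm]
  rfl

/-- The indices other than `a` that sparse vector reports do not depend on the value at `a`. -/
theorem sum_sparseVectorProb_mul_congr {m : ℕ} (α : ℝ) (thr noise : ProbabilityMeasure ℝ)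
    (f f' : Fin m → ℝ) (a : Fin m) (hf : ∀ j, j ≠ a → f j = f' j)
    (h : Finset (Fin m) → ENNReal) (hh : ∀ I I', (∀ j, j ≠ a → (j ∈ I ↔ j ∈ I')) → h I = h I') :
    ∑ I, sparseVectorProb α thr noise f I * h I = ∑ I, sparseVectorProb α thr noise f' I * h I := by
  rw [sum_sparseVectorProb_mul, sum_sparseVectorProb_mul]
  refine lintegral_congr fun p => hh _ _ fun j hj => ?_
  simp [sparseVectorSelect, hf j hj]

theorem sum_sparseVectorProb_mul_le_one {m : ℕ} (α : ℝ) (thr noise : ProbabilityMeasure ℝ)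
    (f : Fin m → ℝ) (h : Finset (Fin m) → ENNReal) (hh : ∀ I, h I ≤ 1) :
    ∑ I, sparseVectorProb α thr noise f I * h I ≤ 1 := by
  rw [sum_sparseVectorProb_mul]
  exact (lintegral_mono fun p => hh _).trans (by simp)

/-! ### Reduction of the mechanism to its transcript -/

section Mechanism

variable {X R : Type*} [MeasurableSpace X] [MeasurableSpace R] {n m T : ℕ}

/-- The law of the output to an analyst with query set `Q`, given the synthetic database `xs` and
whether sparse vector reports the analyst. -/
noncomputable def outputLaw (A : Finset (LinearQuery X) → ProbabilityMeasure R) (xs : Fin T → X)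
    (Q : Finset (LinearQuery X)) (reported : Prop) [Decidable reported] :
    Measure (Output X R T) :=
  if reported then (A Q : Measure R).map fun r => (xs, Sum.inl r)
  else Measure.dirac (xs, Sum.inr ())

instance isProbabilityMeasure_outputLaw
    (A : Finset (LinearQuery X) → ProbabilityMeasure R) (xs : Fin T → X)
    (Q : Finset (LinearQuery X)) (reported : Prop) [Decidable reported] :
    IsProbabilityMeasure (outputLaw A xs Q reported) := by
  unfold outputLaw
  split_ifs
  · exact Measure.isProbabilityMeasure_map (by fun_prop)
  · infer_instance

/-- The law of the outputs to the analysts other than `a`, given the synthetic database `xs`. -/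
noncomputable def othersProb (α : ℝ) (thr noise : ProbabilityMeasure ℝ)
    (A : Finset (LinearQuery X) → ProbabilityMeasure R) (D : Fin n → X)
    (Q : Fin m → Finset (LinearQuery X)) (a : Fin m)
    (S : Set ({j : Fin m // j ≠ a} → Output X R T)) (xs : Fin T → X) : ENNReal :=
  ∑ I : Finset (Fin m), sparseVectorProb α thr noise (fun i => maxError D xs (Q i)) I *
    (Measure.pi fun j : {j : Fin m // j ≠ a} => outputLaw A xs (Q j.1) (j.1 ∈ I)) S

theorem othersProb_le_one (α : ℝ) (thr noise : ProbabilityMeasure ℝ)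
    (A : Finset (LinearQuery X) → ProbabilityMeasure R) (D : Fin n → X)
    (Q : Fin m → Finset (LinearQuery X)) (a : Fin m)
    (S : Set ({j : Fin m // j ≠ a} → Output X R T)) (xs : Fin T → X) :
    othersProb α thr noise A D Q a S xs ≤ 1 :=
  sum_sparseVectorProb_mul_le_one _ _ _ _ _ fun _ => prob_le_one

theorem othersProb_congr (α : ℝ) (thr noise : ProbabilityMeasure ℝ)
    (A : Finset (LinearQuery X) → ProbabilityMeasure R) (D : Fin n → X)
    (Q Q' : Fin m → Finset (LinearQuery X)) (a : Fin m) (hQ : ∀ j, j ≠ a → Q j = Q' j)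
    (S : Set ({j : Fin m // j ≠ a} → Output X R T)) (xs : Fin T → X) :
    othersProb α thr noise A D Q a S xs = othersProb α thr noise A D Q' a S xs := by
  unfold othersProb
  have h : ∀ I : Finset (Fin m),
      (fun j : {j : Fin m // j ≠ a} => outputLaw A xs (Q j.1) (j.1 ∈ I)) =
        fun j => outputLaw A xs (Q' j.1) (j.1 ∈ I) := fun I => by
    funext j
    rw [hQ j.1 j.2]
  simp_rw [h]
  refine sum_sparseVectorProb_mul_congr α thr noise _ _ a (fun j hj => by simp only [hQ j hj])
    (fun I => (Measure.pi fun j : {j : Fin m // j ≠ a} => outputLaw A xs (Q' j.1) (j.1 ∈ I)) S)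
    fun I I' hI => ?_
  have h2 : (fun j : {j : Fin m // j ≠ a} => outputLaw A xs (Q' j.1) (j.1 ∈ I)) =
      fun j => outputLaw A xs (Q' j.1) (j.1 ∈ I') := by
    funext j
    simp only [outputLaw, hI j.1 j.2]
  simp only [h2]

/-- Marginalizing a product of probability laws deletes the factor of `a`. What remains is the law
of the transcript integrated against a conditional probability. -/
theorem mechanism_map_apply [Fintype X] (ε δ α : ℝ) (thr noise : ProbabilityMeasure ℝ)
    (MW : ℝ → ℝ → (Fin n → X) → Finset (LinearQuery X) → ProbabilityMeasure R)
    (D : Fin n → X) (Q : Fin m → Finset (LinearQuery X)) (a : Fin m)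
    {S : Set ({j : Fin m // j ≠ a} → Output X R T)} (hS : MeasurableSet S) :
    ((mechanism T ε δ α thr noise MW D Q).map fun z (j : {j // j ≠ a}) => z j.1) S =
      ∑ xs : Fin T → X,
        ENNReal.ofReal (transcriptProb (ε / (2 * √(T * Real.log (1 / δ)))) (12 * T) D
          (fun i => closeNeg (Q i)) xs) *
        othersProb α thr noise (MW (ε / (10 * √(12 * T * Real.log (3 * (12 * T) / δ))))
          (δ / (3 * (12 * T))) D) D (fun i => closeNeg (Q i)) a S xs := by
  have hmeas : Measurable fun (z : Fin m → Output X R T) (j : {j // j ≠ a}) => z j.1 := by fun_prop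
  rw [Measure.map_apply hmeas hS, mechanism]
  simp only [Measure.finsetSum_apply, Measure.smul_apply, smul_eq_mul]
  refine Finset.sum_congr rfl fun xs _ => ?_
  rw [othersProb, Finset.mul_sum]
  refine Finset.sum_congr rfl fun I _ => ?_
  rw [← map_pi_subtype_eq (fun j => outputLaw _ xs (closeNeg (Q j)) (j ∈ I)) (fun j => j ≠ a),
    Measure.map_apply hmeas hS, mul_assoc]
  rfl

end Mechanism

end OfflineAnalyst

theorem mainTheorem6 {X R : Type*} [Fintype X] [MeasurableSpace X] [DiscreteMeasurableSpace X]
    [MeasurableSpace R] (n m T : ℕ) (hn : 0 < n) (hT : 0 < T) (hTm : 12 * T ≤ m)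
    (ε δ : ℝ) (hε : 0 < ε) (hε1 : ε ≤ 1) (hδ : 0 < δ) (hδ1 : δ < 1)
    (α : ℝ) (thr noise : ProbabilityMeasure ℝ)
    (MW : ℝ → ℝ → (Fin n → X) → Finset (LinearQuery X) → ProbabilityMeasure R) :
    OneAnalystToManyAnalystPrivate (m := m)
      (OfflineAnalyst.mechanism T ε δ α thr noise MW) ε δ := by
  intro D Q Q' a hQ S hS
  have : Nonempty X := ⟨D ⟨0, hn⟩⟩
  have hm : 0 < m := by omega
  rw [OfflineAnalyst.mechanism_map_apply _ _ _ _ _ _ _ _ _ hS,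
    OfflineAnalyst.mechanism_map_apply _ _ _ _ _ _ _ _ _ hS]
  simp_rw [OfflineAnalyst.othersProb_congr α thr noise _ D (fun i => OfflineAnalyst.closeNeg (Q i))
    (fun i => OfflineAnalyst.closeNeg (Q' i)) a (fun j hj => by simp only [hQ j hj])]
  -- After the rewriting above, the same test function `K`, with values in `[0, 1]`, serves both
  -- profiles.
  set K := OfflineAnalyst.othersProb (T := T) α thr noise
    (MW (ε / (10 * √(12 * T * Real.log (3 * (12 * T) / δ)))) (δ / (3 * (12 * T))) D) D
    (fun i => OfflineAnalyst.closeNeg (Q' i)) a S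
  have hK1 : ∀ xs, K xs ≤ 1 := fun xs => OfflineAnalyst.othersProb_le_one _ _ _ _ _ _ _ _ _
  have hK : ∀ xs, K xs = ENNReal.ofReal (K xs).toReal := fun xs =>
    (ENNReal.ofReal_toReal (ne_top_of_le_ne_top ENNReal.one_ne_top (hK1 xs))).symm
  have hP := fun Q : Fin m → Finset (LinearQuery X) =>
    OfflineAnalyst.transcriptProb_nonneg (T := T) hm
      (ε / (2 * √(T * Real.log (1 / δ)))) (12 * T) D fun i => OfflineAnalyst.closeNeg (Q i)
  have hsum : ∀ Q : Fin m → Finset (LinearQuery X),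
      ∑ xs, ENNReal.ofReal (OfflineAnalyst.transcriptProb (ε / (2 * √(T * Real.log (1 / δ))))
        (12 * T) D (fun i => OfflineAnalyst.closeNeg (Q i)) xs) * K xs =
      ENNReal.ofReal (∑ xs, (K xs).toReal *
        OfflineAnalyst.transcriptProb (ε / (2 * √(T * Real.log (1 / δ)))) (12 * T) D
          (fun i => OfflineAnalyst.closeNeg (Q i)) xs) := by
    intro Q
    rw [ENNReal.ofReal_sum_of_nonneg fun xs _ => mul_nonneg ENNReal.toReal_nonneg (hP Q xs)]
    refine Finset.sum_congr rfl fun xs _ => ?_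
    rw [ENNReal.ofReal_mul ENNReal.toReal_nonneg, ← hK, mul_comm]
  rw [hsum, hsum, ← ENNReal.ofReal_mul (Real.exp_pos _).le, ← ENNReal.ofReal_add
    (mul_nonneg (Real.exp_pos _).le (Finset.sum_nonneg fun xs _ =>
      mul_nonneg ENNReal.toReal_nonneg (hP Q' xs))) hδ.le]
  exact ENNReal.ofReal_le_ofReal (OfflineAnalyst.sum_mul_transcriptProb_le hn hT hTm hε hε1 hδ hδ1
    D Q Q' a hQ _ (fun _ => ENNReal.toReal_nonneg) fun xs =>
      ENNReal.toReal_le_of_le_ofReal zero_le_one (by simpa using hK1 xs))
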